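/- Let $\Gamma$ be a countable discrete group with identity $e$, let $\lambda$ be its left regular representation on $\ell_2(\Gamma)$, $\lambda(\gamma)\delta_{\gamma'}=\delta_{\gamma\gamma'}$, and let $\mathrm{vNa}(\Gamma)\subset\mathcal B(\ell_2(\Gamma))$ be the group von Neumann algebra, i.e. the closure of $\mathrm{span}\{\lambda(\gamma)\}_{\gamma\in\Gamma}$ in the weak operator topology, with the trace $\tau(F)=\langle F\delta_e,\delta_e\rangle$ (inner products are linear in the first variable). Let $L^1(\mathrm{vNa}(\Gamma))$ be the completion of $\mathrm{vNa}(\Gamma)$ in the norm $\|F\|_1=\tau(|F|)$, $|F|=(F^*F)^{1/2}$; the trace, the adjoint and the multiplications by elements of $\mathrm{vNa}(\Gamma)$ are extended to it by continuity, and an element of it is called positive if it is a $\|\cdot\|_1$-limit of positive operators in $\mathrm{vNa}(\Gamma)$. Let $T:\Gamma\to U(\mathcal H)$ be a dual integrable unitary representation on a complex Hilbert space $\mathcal H$, with bracket $[\cdot,\cdot]$; that is, $[\cdot,\cdot]:\mathcal H\times\mathcal H\to L^1(\mathrm{vNa}(\Gamma))$ is a map such that $$\langle\varphi,T(\gamma)\psi\rangle_{\mathcal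 H}=\tau\big([\varphi,\psi]\lambda(\gamma)^*\big)\qquad\text{for all }\varphi,\psi\in\mathcal H,\ \gamma\in\Gamma.$$ Then, for all $\psi,\psi_1,\psi_2\in\mathcal H$ and $\gamma\in\Gamma$: (I) the bracket is sesquilinear (linear in the first variable, conjugate-linear in the second) and $[\psi_1,\psi_2]^*=[\psi_2,\psi_1]$; (II) $[T(\gamma)\psi_1,\psi_2]=\lambda(\gamma)[\psi_1,\psi_2]$ and $[\psi_1,T(\gamma)\psi_2]=[\psi_1,\psi_2]\lambda(\gamma)^*$; (III) $[\psi,\psi]$ is positive and $\|[\psi,\psi]\|_1=\|\psi\|_{\mathcal H}^2$. -/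

import Mathlib

open scoped ComplexConjugate InnerProductSpace

set_option linter.unusedSectionVars false

noncomputable section

namespace GroupVN

section Polar

variable {H : Type*} [NormedAddCommGroup H] [InnerProductSpace ℂ H] [CompleteSpace H]

/-- The absolute value `|F| = (F* F)^{1/2}` of a bounded operator. -/
def opAbs (F : H →L[ℂ] H) : H →L[ℂ] H := CFC.abs F

/-- `τ(|F|)` for the vector functional `τ(F) = ⟨F ξ, ξ⟩`. -/
def absTrace (ξ : H) (F : H →L[ℂ] H) : ℝ := (⟪ξ, opAbs F ξ⟫_ℂ).re

lemma opAbs_nonneg (F : H →L[ℂ] H) : 0 ≤ opAbs F := CFC.abs_nonneg F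

lemma inner_opAbs (ξ : H) (F : H →L[ℂ] H) : ⟪ξ, opAbs F ξ⟫_ℂ = absTrace ξ F := by
  have h := ((ContinuousLinearMap.nonneg_iff_isPositive _).1 (opAbs_nonneg F)).isSymmetric
  refine (Complex.conj_eq_iff_re.1 ?_).symm
  rw [inner_conj_symm]
  exact h ξ ξ

lemma absTrace_nonneg (ξ : H) (F : H →L[ℂ] H) : 0 ≤ absTrace ξ F :=
  ((ContinuousLinearMap.nonneg_iff_isPositive _).1 (opAbs_nonneg F)).re_inner_nonneg_right ξ

/-- Regularised polar decomposition. -/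
lemma exists_polar (F : H →L[ℂ] H) {ε : ℝ} (hε : 0 < ε) :
    ∃ R : H →L[ℂ] H, (∃ f : ℝ → ℝ, R = cfc f (opAbs F)) ∧ ‖F * R‖ ≤ 1 ∧
      F * R * opAbs F + (ε : ℂ) • (F * R) = F ∧
      ‖opAbs F - star (F * R) * F‖ ≤ ε := by
  set P := opAbs F with hP
  have hP0 : 0 ≤ P := CFC.abs_nonneg F
  have hPsa : IsSelfAdjoint P := hP0.isSelfAdjoint
  have hspec : ∀ x ∈ spectrum ℝ P, 0 ≤ x := fun x hx => spectrum_nonneg_of_nonneg hP0 hx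
  have hcont : ContinuousOn (fun x : ℝ => (x + ε)⁻¹) (spectrum ℝ P) := by
    refine ContinuousOn.inv₀ (by fun_prop) fun x hx => ?_
    have := hspec x hx
    positivity
  have hcid : ContinuousOn (fun x : ℝ => x) (spectrum ℝ P) := continuousOn_id
  have hcsq : ContinuousOn (fun x : ℝ => x * x) (spectrum ℝ P) := by fun_prop
  have hc2 : ContinuousOn (fun x : ℝ => (x + ε)⁻¹ * (x * x)) (spectrum ℝ P) := hcont.mul hcsq
  have hc1 : ContinuousOn (fun x : ℝ => (x + ε)⁻¹ * x) (spectrum ℝ P) := hcont.mul hcid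
  have hc0 : ContinuousOn (fun x : ℝ => ε * (x + ε)⁻¹) (spectrum ℝ P) :=
    continuousOn_const.mul hcont
  have hid : cfc (fun x : ℝ => x) P = P := cfc_id' ℝ P
  have hPP : P * P = star F * F := CFC.abs_mul_abs F
  set R := cfc (fun x : ℝ => (x + ε)⁻¹) P with hR
  have hRsa : star R = R := (cfc_predicate (R := ℝ) _ P : IsSelfAdjoint _).star_eq
  have hstar : star (F * R) * F = cfc (fun x : ℝ => (x + ε)⁻¹ * (x * x)) P := by
    rw [star_mul, hRsa, mul_assoc, ← hPP, cfc_mul _ _ P hcont (by fun_prop),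
      cfc_mul _ _ P (by fun_prop) (by fun_prop), hid]
  refine ⟨R, ⟨_, rfl⟩, ?_, ?_, ?_⟩
  · have h1 : star (F * R) * (F * R) =
        cfc (fun x : ℝ => (x + ε)⁻¹ * (x * x) * (x + ε)⁻¹) P := by
      rw [← mul_assoc, hstar, hR, cfc_mul _ _ P hc2 hcont]
    have h2 : ‖star (F * R) * (F * R)‖ ≤ 1 := by
      rw [h1]
      refine norm_cfc_le zero_le_one fun x hx => ?_
      have hx0 := hspec x hx
      rw [Real.norm_of_nonneg (by positivity)]
      have : (x + ε)⁻¹ * (x * x) * (x + ε)⁻¹ = (x / (x + ε)) ^ 2 := by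
        field_simp
      rw [this]
      refine pow_le_one₀ (by positivity) ?_
      rw [div_le_one (by positivity)]
      linarith
    rw [CStarRing.norm_star_mul_self] at h2
    nlinarith [norm_nonneg (F * R)]
  · have h1 : R * P + (ε : ℂ) • R = 1 := by
      have h3 : (ε : ℂ) • R = ε • R := Complex.coe_smul ε R
      rw [h3, hR, ← cfc_const_mul ε _ P hcont]
      conv_lhs => arg 1; arg 2; rw [← hid]
      rw [← cfc_mul _ _ P hcont (by fun_prop),
        ← cfc_add (a := P) _ _ hc1 hc0, ← cfc_one ℝ P]
      refine cfc_congr fun x hx => ?_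
      have hx0 := hspec x hx
      have : x + ε ≠ 0 := by positivity
      simp only [Pi.one_apply]
      field_simp
    rw [mul_assoc, ← mul_smul_comm, ← mul_add, h1, mul_one]
  · rw [hstar]
    conv_lhs => arg 1; arg 1; rw [← hid]
    rw [← cfc_sub _ _ P hcid hc2]
    refine norm_cfc_le hε.le fun x hx => ?_
    have hx0 := hspec x hx
    have h5 : x - (x + ε)⁻¹ * (x * x) = ε * (x / (x + ε)) := by
      field_simp
      ring
    rw [h5, Real.norm_of_nonneg (by positivity)]
    refine mul_le_of_le_one_right hε.le ?_
    rw [div_le_one (by positivity)]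
    linarith

variable {M : StarSubalgebra ℂ (H →L[ℂ] H)}

lemma opAbs_mem (hM : IsClosed (M : Set (H →L[ℂ] H)))
    {F : H →L[ℂ] H} (hF : F ∈ M) : opAbs F ∈ M := by
  have := hM
  rw [opAbs, CFC.abs, CFC.sqrt_eq_real_sqrt _ (star_mul_self_nonneg F)]
  exact cfcₙ_mem (s := M) _ (mul_mem (star_mem hF) hF)

lemma sqrt_mem (hM : IsClosed (M : Set (H →L[ℂ] H)))
    {F : H →L[ℂ] H} (h0 : 0 ≤ F) (hF : F ∈ M) : CFC.sqrt F ∈ M := by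
  have := hM
  rw [CFC.sqrt_eq_real_sqrt _ h0]
  exact cfcₙ_mem (s := M) _ hF

lemma polar_mem (hM : IsClosed (M : Set (H →L[ℂ] H)))
    {F : H →L[ℂ] H} (hF : F ∈ M) {R : H →L[ℂ] H}
    (hR : ∃ f : ℝ → ℝ, R = cfc f (opAbs F)) : F * R ∈ M := by
  have := hM
  obtain ⟨f, rfl⟩ := hR
  exact mul_mem hF (cfc_mem (s := M) f (opAbs_mem hM hF))

lemma norm_inner_apply_le (ξ : H) (A : H →L[ℂ] H) : ‖⟪ξ, A ξ⟫_ℂ‖ ≤ ‖A‖ * ‖ξ‖ ^ 2 := by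
  refine (norm_inner_le_norm (𝕜 := ℂ) _ _).trans ?_
  nlinarith [A.le_opNorm ξ, norm_nonneg ξ]

variable {ξ : H}

/-- `|τ(GF)| ≤ ‖G‖ τ(|F|)`. -/
lemma norm_inner_mul_le (hM : IsClosed (M : Set (H →L[ℂ] H)))
    (hξ : ∀ A ∈ M, ∀ B ∈ M, ⟪ξ, (A * B) ξ⟫_ℂ = ⟪ξ, (B * A) ξ⟫_ℂ)
    {G F : H →L[ℂ] H} (hG : G ∈ M) (hF : F ∈ M) :
    ‖⟪ξ, (G * F) ξ⟫_ℂ‖ ≤ ‖G‖ * absTrace ξ F := by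
  refine le_of_forall_pos_le_add fun δ hδ => ?_
  set ε : ℝ := δ / (‖G‖ * ‖ξ‖ ^ 2 + 1) with hεdef
  have hε : 0 < ε := by positivity
  obtain ⟨R, hR, h1, h2, -⟩ := exists_polar F hε
  have hW := polar_mem hM hF hR
  set W := F * R
  set P := opAbs F with hP
  have hP0 : 0 ≤ P := opAbs_nonneg F
  set S := CFC.sqrt P with hS
  have hSS : S * S = P := CFC.sqrt_mul_sqrt_self P hP0
  have hSsa : star S = S := (CFC.sqrt_nonneg P).isSelfAdjoint.star_eq
  have hSM : S ∈ M := sqrt_mem hM hP0 (opAbs_mem hM hF)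
  have hadj : ∀ x y : H, ⟪x, S y⟫_ℂ = ⟪S x, y⟫_ℂ := by
    intro x y
    rw [← ContinuousLinearMap.adjoint_inner_left, ← ContinuousLinearMap.star_eq_adjoint, hSsa]
  have hGW : ‖G * W‖ ≤ ‖G‖ := (norm_mul_le _ _).trans (mul_le_of_le_one_right (norm_nonneg _) h1)
  have hSn : ‖S ξ‖ ^ 2 = absTrace ξ F := by
    have h3 : (⟪ξ, P ξ⟫_ℂ) = ⟪S ξ, S ξ⟫_ℂ := by
      rw [← hSS, ← hadj]; rfl
    rw [absTrace, ← hP, h3, inner_self_eq_norm_sq_to_K]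
    norm_cast
  have hdec : G * F = (G * W * S) * S + (ε : ℂ) • (G * W) := by
    conv_lhs => rw [← h2]
    rw [mul_add, mul_smul_comm, mul_assoc (G * W) S S, hSS, mul_assoc G W P]
  have ha : ‖⟪ξ, ((G * W * S) * S) ξ⟫_ℂ‖ ≤ ‖G‖ * absTrace ξ F := by
    rw [hξ _ (mul_mem (mul_mem hG hW) hSM) _ hSM]
    have : ⟪ξ, (S * (G * W * S)) ξ⟫_ℂ = ⟪S ξ, (G * W) (S ξ)⟫_ℂ := by
      rw [← hadj]; rfl
    rw [this, ← hSn]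
    exact (norm_inner_apply_le _ _).trans (by gcongr)
  have hb : ‖⟪ξ, ((ε : ℂ) • (G * W)) ξ⟫_ℂ‖ ≤ δ := by
    refine (norm_inner_apply_le _ _).trans ?_
    rw [norm_smul, Complex.norm_real, Real.norm_of_nonneg hε.le]
    calc ε * ‖G * W‖ * ‖ξ‖ ^ 2 ≤ ε * ‖G‖ * ‖ξ‖ ^ 2 := by gcongr
      _ ≤ ε * (‖G‖ * ‖ξ‖ ^ 2 + 1) := by nlinarith
      _ = δ := by rw [hεdef]; field_simp
  rw [hdec, add_apply, inner_add_right]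
  exact (norm_add_le _ _).trans (add_le_add ha hb)

/-- `τ(|F|)` is approximated by `|τ(WF)|` with contractions `W` of the algebra. -/
lemma exists_absTrace_le (hM : IsClosed (M : Set (H →L[ℂ] H)))
    {F : H →L[ℂ] H} (hF : F ∈ M) {δ : ℝ} (hδ : 0 < δ) :
    ∃ W ∈ M, ‖W‖ ≤ 1 ∧ absTrace ξ F ≤ ‖⟪ξ, (W * F) ξ⟫_ℂ‖ + δ := by
  set ε : ℝ := δ / (‖ξ‖ ^ 2 + 1) with hεdef
  have hε : 0 < ε := by positivity
  obtain ⟨R, hR, h1, -, h2⟩ := exists_polar F hε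
  refine ⟨star (F * R), star_mem (polar_mem hM hF hR), by rwa [norm_star], ?_⟩
  have h3 : absTrace ξ F = ‖⟪ξ, opAbs F ξ⟫_ℂ‖ := by
    rw [inner_opAbs, Complex.norm_real, Real.norm_of_nonneg (absTrace_nonneg _ _)]
  have h4 : opAbs F = star (F * R) * F + (opAbs F - star (F * R) * F) := by abel
  rw [h3]
  conv_lhs => rw [h4]
  rw [add_apply, inner_add_right]
  refine (norm_add_le _ _).trans (add_le_add le_rfl ?_)
  refine (norm_inner_apply_le _ _).trans ?_
  calc _ ≤ ε * ‖ξ‖ ^ 2 := by gcongr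
    _ ≤ ε * (‖ξ‖ ^ 2 + 1) := by nlinarith
    _ = δ := by rw [hεdef]; field_simp

/-- A bound on all `|τ(WF)|`, `‖W‖ ≤ 1`, bounds `τ(|F|)`. -/
lemma absTrace_le (hM : IsClosed (M : Set (H →L[ℂ] H)))
    {F : H →L[ℂ] H} (hF : F ∈ M) {C : ℝ}
    (h : ∀ W ∈ M, ‖W‖ ≤ 1 → ‖⟪ξ, (W * F) ξ⟫_ℂ‖ ≤ C) : absTrace ξ F ≤ C := by
  refine le_of_forall_pos_le_add fun δ hδ => ?_
  obtain ⟨W, hW, h1, h2⟩ := exists_absTrace_le (ξ := ξ) hM hF hδ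
  linarith [h W hW h1]

end Polar

section GroupAlgebra

variable (Γ : Type*) [Group Γ]

/-- The Hilbert space `ℓ₂(Γ)`. -/
abbrev Ell2 : Type _ := lp (fun _ : Γ => ℂ) 2

/-- Bounded operators on `ℓ₂(Γ)`. -/
abbrev Op : Type _ := Ell2 Γ →L[ℂ] Ell2 Γ

variable {Γ}

open scoped Classical in
/-- The canonical basis vector `δ_γ` of `ℓ₂(Γ)`. -/
def delta (γ : Γ) : Ell2 Γ := lp.single 2 γ (1 : ℂ)

lemma memℓp_translate (γ : Γ) (f : Ell2 Γ) : Memℓp (fun x => f (γ⁻¹ * x)) 2 := by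
  have h2 : 0 < (2 : ENNReal).toReal := by norm_num
  rw [memℓp_gen_iff h2]
  exact ((Equiv.mulLeft γ⁻¹).summable_iff (f := fun x => ‖f x‖ ^ (2 : ENNReal).toReal)).2
    ((memℓp_gen_iff h2).1 f.2)

/-- Left translation `(γ f)(x) = f (γ⁻¹ x)` on `ℓ₂(Γ)`, as a linear isometry. -/
def translate (γ : Γ) : Ell2 Γ →ₗᵢ[ℂ] Ell2 Γ where
  toFun f := ⟨fun x => f (γ⁻¹ * x), memℓp_translate γ f⟩
  map_add' f g := rfl
  map_smul' c f := rfl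
  norm_map' f := by
    have h2 : 0 < (2 : ENNReal).toReal := by norm_num
    rw [lp.norm_eq_tsum_rpow h2, lp.norm_eq_tsum_rpow h2]
    congr 1
    exact (Equiv.mulLeft γ⁻¹).tsum_eq (fun x => ‖f x‖ ^ (2 : ENNReal).toReal)

variable (Γ) in
/-- The left regular representation `λ` of `Γ` on `ℓ₂(Γ)`. -/
def leftRegular : Γ →* Op Γ where
  toFun γ := (translate γ).toContinuousLinearMap
  map_one' := by
    ext f x
    simp [translate]
  map_mul' a b := by
    ext f x
    change f ((a * b)⁻¹ * x) = f (b⁻¹ * (a⁻¹ * x))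
    rw [mul_inv_rev, mul_assoc]

lemma leftRegular_apply (γ : Γ) (f : Ell2 Γ) (x : Γ) :
    leftRegular Γ γ f x = f (γ⁻¹ * x) := rfl

open scoped Classical in
lemma leftRegular_delta (γ γ' : Γ) : leftRegular Γ γ (delta γ') = delta (γ * γ') := by
  ext x
  rw [leftRegular_apply]
  simp only [delta, lp.single_apply, Pi.single_apply]
  simp only [inv_mul_eq_iff_eq_mul]

lemma star_leftRegular (γ : Γ) : star (leftRegular Γ γ) = leftRegular Γ γ⁻¹ := by
  rw [ContinuousLinearMap.star_eq_adjoint]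
  symm
  rw [ContinuousLinearMap.eq_adjoint_iff]
  intro f g
  have h1 : (leftRegular Γ γ) ((leftRegular Γ γ⁻¹) f) = f := by
    rw [← mul_apply_eq_comp, ← map_mul]; simp
  conv_rhs => rw [← h1]
  exact ((translate γ).inner_map_map _ _).symm

/-- Trigonometric polynomials: the linear span of the `λ(γ)`. -/
def trigPoly (Γ : Type*) [Group Γ] : Submodule ℂ (Op Γ) :=
  Submodule.span ℂ (Set.range (leftRegular Γ))

lemma trigPoly_mul {a b : Op Γ} (ha : a ∈ trigPoly Γ) (hb : b ∈ trigPoly Γ) :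
    a * b ∈ trigPoly Γ := by
  have h := Submodule.mul_mem_mul ha hb
  rw [trigPoly, Submodule.span_mul_span] at h
  refine Submodule.span_mono ?_ h
  rintro _ ⟨_, ⟨x, rfl⟩, _, ⟨y, rfl⟩, rfl⟩
  exact ⟨x * y, map_mul _ _ _⟩

lemma trigPoly_star {a : Op Γ} (ha : a ∈ trigPoly Γ) : star a ∈ trigPoly Γ := by
  induction ha using Submodule.span_induction with
  | mem x hx =>
    obtain ⟨γ, rfl⟩ := hx
    rw [star_leftRegular]
    exact Submodule.subset_span ⟨_, rfl⟩
  | zero => rw [star_zero]; exact zero_mem _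
  | add x y _ _ hx hy => rw [star_add]; exact add_mem hx hy
  | smul c x _ hx => rw [star_smul]; exact Submodule.smul_mem _ _ hx

/-- Membership in the closure of the trigonometric polynomials in the weak operator topology. -/
def IsWOTLimit (F : Op Γ) : Prop :=
  ContinuousLinearMapWOT.ofCLM F ∈
    closure (ContinuousLinearMapWOT.ofCLM '' (trigPoly Γ : Set (Op Γ)))

lemma continuous_wot_mulLeft (a : Op Γ) :
    Continuous fun T : Ell2 Γ →WOT[ℂ] Ell2 Γ => ContinuousLinearMapWOT.ofCLM a * T := by
  rw [ContinuousLinearMapWOT.continuous_iff]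
  intro x y
  have : (fun T : Ell2 Γ →WOT[ℂ] Ell2 Γ => ⟪y, (ContinuousLinearMapWOT.ofCLM a * T) x⟫_ℂ)
      = fun T => ⟪ContinuousLinearMap.adjoint a y, T x⟫_ℂ := by
    funext T
    rw [ContinuousLinearMap.adjoint_inner_left]
    rfl
  rw [this]
  exact ContinuousLinearMapWOT.continuous_inner_apply continuous_id _ _

lemma continuous_wot_mulRight (a : Op Γ) :
    Continuous fun T : Ell2 Γ →WOT[ℂ] Ell2 Γ => T * ContinuousLinearMapWOT.ofCLM a := by
  rw [ContinuousLinearMapWOT.continuous_iff]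
  intro x y
  exact ContinuousLinearMapWOT.continuous_inner_apply continuous_id (a x) y

lemma isWOTLimit_of_mem {a : Op Γ} (ha : a ∈ trigPoly Γ) : IsWOTLimit a :=
  subset_closure ⟨a, ha, rfl⟩

lemma IsWOTLimit.mul {a b : Op Γ} (ha : IsWOTLimit a) (hb : IsWOTLimit b) :
    IsWOTLimit (a * b) := by
  have step : ∀ c ∈ trigPoly Γ, IsWOTLimit (c * b) := by
    intro c hc
    refine map_mem_closure (f := fun T => ContinuousLinearMapWOT.ofCLM c * T)
      (continuous_wot_mulLeft c) hb ?_
    rintro _ ⟨d, hd, rfl⟩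
    exact ⟨c * d, trigPoly_mul hc hd, rfl⟩
  have h := map_mem_closure (f := fun T => T * ContinuousLinearMapWOT.ofCLM b) (t := closure (ContinuousLinearMapWOT.ofCLM ''
    (trigPoly Γ : Set (Op Γ)))) (continuous_wot_mulRight b) ha (by
      rintro _ ⟨d, hd, rfl⟩
      exact step d hd)
  rwa [closure_closure] at h

lemma IsWOTLimit.add {a b : Op Γ} (ha : IsWOTLimit a) (hb : IsWOTLimit b) :
    IsWOTLimit (a + b) := by
  refine map_mem_closure₂ continuous_add ha hb ?_
  rintro _ ⟨c, hc, rfl⟩ _ ⟨d, hd, rfl⟩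
  exact ⟨c + d, add_mem hc hd, rfl⟩

lemma IsWOTLimit.star {a : Op Γ} (ha : IsWOTLimit a) : IsWOTLimit (star a) := by
  refine map_mem_closure (f := fun T : Ell2 Γ →WOT[ℂ] Ell2 Γ => Star.star T)
    continuous_star ha ?_
  rintro _ ⟨c, hc, rfl⟩
  exact ⟨Star.star c, trigPoly_star hc, rfl⟩

lemma isWOTLimit_algebraMap (c : ℂ) : IsWOTLimit (algebraMap ℂ (Op Γ) c) := by
  apply isWOTLimit_of_mem
  rw [Algebra.algebraMap_eq_smul_one, ← map_one (leftRegular Γ)]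
  exact Submodule.smul_mem _ _ (Submodule.subset_span ⟨1, rfl⟩)

variable (Γ) in
/-- The group von Neumann algebra of `Γ`: the closure of the trigonometric polynomials in the
weak operator topology. -/
def vNa : StarSubalgebra ℂ (Op Γ) where
  carrier := {F | IsWOTLimit F}
  mul_mem' := IsWOTLimit.mul
  add_mem' := IsWOTLimit.add
  algebraMap_mem' := isWOTLimit_algebraMap
  star_mem' := IsWOTLimit.star

lemma isClosed_vNa : IsClosed (vNa Γ : Set (Op Γ)) := by
  have hc : Continuous (ContinuousLinearMapWOT.ofCLM : Op Γ → Ell2 Γ →WOT[ℂ] Ell2 Γ) := by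
    rw [ContinuousLinearMapWOT.continuous_iff]
    intro x y
    exact continuous_const.inner ((ContinuousLinearMap.apply ℂ (Ell2 Γ) x).continuous)
  exact isClosed_closure.preimage hc

/-- `λ(γ)` as an element of the group von Neumann algebra. -/
def lam (γ : Γ) : vNa Γ := ⟨leftRegular Γ γ, isWOTLimit_of_mem (Submodule.subset_span ⟨γ, rfl⟩)⟩

/-- The standard normalized trace `τ(F) = ⟨F δ_e, δ_e⟩` (Mathlib's inner product is linear in its
second argument). -/
def tau : Op Γ →ₗ[ℂ] ℂ where
  toFun F := ⟪delta (1 : Γ), F (delta 1)⟫_ℂ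
  map_add' F G := by simp
  map_smul' c F := by simp

lemma tau_apply (F : Op Γ) : tau F = ⟪delta (1 : Γ), F (delta 1)⟫_ℂ := rfl

lemma norm_delta (γ : Γ) : ‖delta γ‖ = 1 := by
  classical
  simp [delta, lp.norm_single]

lemma norm_tau_le (F : Op Γ) : ‖tau F‖ ≤ ‖F‖ := by
  refine (norm_inner_le_norm (𝕜 := ℂ) (delta (1 : Γ)) (F (delta 1))).trans ?_
  rw [norm_delta, one_mul]
  simpa [norm_delta] using F.le_opNorm (delta (1 : Γ))

lemma tau_star (F : Op Γ) : tau (star F) = conj (tau F) := by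
  rw [tau_apply, tau_apply, ContinuousLinearMap.star_eq_adjoint,
    ContinuousLinearMap.adjoint_inner_right, inner_conj_symm]

open scoped Classical in
lemma tau_lam_mul (x y : Γ) :
    tau (leftRegular Γ x * leftRegular Γ y) = tau (leftRegular Γ y * leftRegular Γ x) := by
  rw [← map_mul, ← map_mul, tau_apply, tau_apply, leftRegular_delta, leftRegular_delta]
  simp only [mul_one, delta, lp.inner_single_left, lp.single_apply, Pi.single_apply]
  congr 1
  have h : (1 : Γ) = x * y ↔ 1 = y * x := by
    rw [eq_comm, mul_eq_one_iff_eq_inv, eq_comm (a := (1 : Γ)), mul_eq_one_iff_inv_eq, eq_comm]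
  simp only [h]

lemma tau_mul_comm_trig {a b : Op Γ} (ha : a ∈ trigPoly Γ) (hb : b ∈ trigPoly Γ) :
    tau (a * b) = tau (b * a) := by
  induction ha using Submodule.span_induction with
  | zero => simp
  | add x y _ _ hx hy => rw [add_mul, mul_add, map_add, map_add, hx, hy]
  | smul c x _ hx => rw [smul_mul_assoc, mul_smul_comm, map_smul, map_smul, hx]
  | mem x hx =>
    obtain ⟨γ, rfl⟩ := hx
    induction hb using Submodule.span_induction with
    | zero => simp
    | add x y _ _ hx hy => rw [add_mul, mul_add, map_add, map_add, hx, hy]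
    | smul c x _ hx => rw [smul_mul_assoc, mul_smul_comm, map_smul, map_smul, hx]
    | mem y hy =>
      obtain ⟨γ', rfl⟩ := hy
      exact tau_lam_mul γ γ'

/-- If two weak-operator continuous functions agree on trigonometric polynomials, they agree on
their weak operator closure. -/
lemma eq_of_wot {f g : (Ell2 Γ →WOT[ℂ] Ell2 Γ) → ℂ} (hf : Continuous f) (hg : Continuous g)
    (h : ∀ a ∈ trigPoly Γ, f (.ofCLM a) = g (.ofCLM a)) {b : Op Γ} (hb : IsWOTLimit b) :
    f (.ofCLM b) = g (.ofCLM b) := by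
  have hc : IsClosed {T | f T = g T} := isClosed_eq hf hg
  refine (closure_minimal ?_ hc) hb
  rintro _ ⟨a, ha, rfl⟩
  exact h a ha

lemma continuous_wot_tau : Continuous fun T : Ell2 Γ →WOT[ℂ] Ell2 Γ => tau T.toCLM :=
  ContinuousLinearMapWOT.continuous_inner_apply continuous_id (delta 1) (delta 1)

/-- `τ` is tracial on the group von Neumann algebra. -/
lemma tau_mul_comm {a b : Op Γ} (ha : a ∈ vNa Γ) (hb : b ∈ vNa Γ) :
    tau (a * b) = tau (b * a) := by
  have hL := fun c : Op Γ => continuous_wot_tau.comp (continuous_wot_mulLeft c)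
  have hR := fun c : Op Γ => continuous_wot_tau.comp (continuous_wot_mulRight c)
  have step : ∀ c ∈ trigPoly Γ, tau (c * b) = tau (b * c) := fun c hc =>
    eq_of_wot (hL c) (hR c) (fun d hd => tau_mul_comm_trig hc hd) hb
  exact eq_of_wot (hR b) (hL b) step ha

end GroupAlgebra

section L1

variable {Γ : Type*} [Group Γ]

lemma tau_trace_vector : ∀ A ∈ vNa Γ, ∀ B ∈ vNa Γ,
    ⟪delta (1 : Γ), (A * B) (delta 1)⟫_ℂ = ⟪delta (1 : Γ), (B * A) (delta 1)⟫_ℂ :=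
  fun _ hA _ hB => tau_mul_comm hA hB

/-- The trace norm `‖F‖₁ = τ(|F|)` of an element of the group von Neumann algebra. -/
def traceNorm (F : vNa Γ) : ℝ := (tau (opAbs (F : Op Γ))).re

lemma norm_tau_mul_le (G F : vNa Γ) :
    ‖tau ((G : Op Γ) * (F : Op Γ))‖ ≤ ‖(G : Op Γ)‖ * traceNorm F :=
  norm_inner_mul_le isClosed_vNa tau_trace_vector G.2 F.2

lemma traceNorm_le {F : vNa Γ} {C : ℝ}
    (h : ∀ W : vNa Γ, ‖(W : Op Γ)‖ ≤ 1 → ‖tau ((W : Op Γ) * (F : Op Γ))‖ ≤ C) :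
    traceNorm F ≤ C :=
  absTrace_le isClosed_vNa F.2 fun W hW hn => h ⟨W, hW⟩ hn

lemma traceNorm_nonneg (F : vNa Γ) : 0 ≤ traceNorm F := absTrace_nonneg _ _

lemma norm_tau_mul_le_of_contraction (W F : vNa Γ) (hW : ‖(W : Op Γ)‖ ≤ 1) :
    ‖tau ((W : Op Γ) * (F : Op Γ))‖ ≤ traceNorm F :=
  (norm_tau_mul_le W F).trans (mul_le_of_le_one_left (traceNorm_nonneg F) hW)

lemma traceNorm_zero : traceNorm (0 : vNa Γ) = 0 :=
  le_antisymm (traceNorm_le fun W _ => by simp) (traceNorm_nonneg _)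

lemma traceNorm_add_le (F G : vNa Γ) : traceNorm (F + G) ≤ traceNorm F + traceNorm G := by
  refine traceNorm_le fun W hW => ?_
  rw [AddMemClass.coe_add, mul_add, map_add]
  exact (norm_add_le _ _).trans (add_le_add (norm_tau_mul_le_of_contraction W F hW)
    (norm_tau_mul_le_of_contraction W G hW))

lemma traceNorm_smul_le (c : ℂ) (F : vNa Γ) : traceNorm (c • F) ≤ ‖c‖ * traceNorm F := by
  refine traceNorm_le fun W hW => ?_
  rw [SetLike.val_smul, mul_smul_comm, map_smul, norm_smul]
  gcongr
  exact norm_tau_mul_le_of_contraction W F hW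

lemma traceNorm_neg (F : vNa Γ) : traceNorm (-F) = traceNorm F := by
  have h : ∀ G : vNa Γ, traceNorm (-G) ≤ traceNorm G := fun G => by
    simpa using traceNorm_smul_le (-1) G
  exact le_antisymm (h F) (by simpa using h (-F))

lemma traceNorm_mul_le (G F : vNa Γ) : traceNorm (G * F) ≤ ‖(G : Op Γ)‖ * traceNorm F := by
  refine traceNorm_le fun W hW => ?_
  rw [MulMemClass.coe_mul, ← mul_assoc]
  refine (norm_tau_mul_le (W * G) F).trans ?_
  gcongr
  · exact traceNorm_nonneg F
  · exact (norm_mul_le _ _).trans (mul_le_of_le_one_left (norm_nonneg _) hW)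

lemma traceNorm_mul_le' (F G : vNa Γ) : traceNorm (F * G) ≤ ‖(G : Op Γ)‖ * traceNorm F := by
  refine traceNorm_le fun W hW => ?_
  rw [MulMemClass.coe_mul, ← mul_assoc, tau_mul_comm (mul_mem W.2 F.2) G.2, ← mul_assoc]
  refine (norm_tau_mul_le (G * W) F).trans ?_
  gcongr
  · exact traceNorm_nonneg F
  · exact (norm_mul_le _ _).trans (mul_le_of_le_one_right (norm_nonneg _) hW)

lemma traceNorm_star_le (F : vNa Γ) : traceNorm (star F) ≤ traceNorm F := by
  refine traceNorm_le fun W hW => ?_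
  have h : (W : Op Γ) * ((star F : vNa Γ) : Op Γ) = star ((F : Op Γ) * star (W : Op Γ)) := by
    rw [star_mul, star_star]; rfl
  rw [h, tau_star, RCLike.norm_conj, tau_mul_comm F.2 (star_mem W.2)]
  refine norm_tau_mul_le_of_contraction (star W) F ?_
  exact (norm_star (W : Op Γ)).trans_le hW

variable (Γ) in
/-- The group von Neumann algebra as a vector space, to be normed by `‖F‖₁ = τ(|F|)`
instead of the operator norm. -/
def L1Core : Type _ := vNa Γ

instance : AddCommGroup (L1Core Γ) := inferInstanceAs (AddCommGroup (vNa Γ))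

instance : Module ℂ (L1Core Γ) := inferInstanceAs (Module ℂ (vNa Γ))

/-- The trace norm as an additive seminorm. -/
def traceSeminorm (Γ : Type*) [Group Γ] : AddGroupSeminorm (L1Core Γ) where
  toFun F := traceNorm (Γ := Γ) F
  map_zero' := traceNorm_zero
  add_le' := traceNorm_add_le
  neg' := traceNorm_neg

instance : SeminormedAddCommGroup (L1Core Γ) := (traceSeminorm Γ).toSeminormedAddCommGroup

instance : NormedSpace ℂ (L1Core Γ) where
  norm_smul_le c F := traceNorm_smul_le (Γ := Γ) c F

variable (Γ) in
/-- The noncommutative space `L¹(vNa(Γ))`: the completion of the group von Neumann algebra in the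
norm `‖F‖₁ = τ(|F|)`. -/
abbrev L1 : Type _ := UniformSpace.Completion (L1Core Γ)

/-- The inclusion `vNa(Γ) ⊆ L¹(vNa(Γ))`. -/
def toL1 (F : vNa Γ) : L1 Γ := ((show L1Core Γ from F : L1Core Γ) : UniformSpace.Completion (L1Core Γ))

lemma norm_toL1 (F : vNa Γ) : ‖toL1 F‖ = (tau (opAbs (F : Op Γ))).re :=
  UniformSpace.Completion.norm_coe _

namespace L1

/-- The trace on `vNa(Γ)`, continuous for the trace norm. -/
def trCore : L1Core Γ →L[ℂ] ℂ :=
  LinearMap.mkContinuous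
    { toFun := fun F => tau ((show vNa Γ from F : vNa Γ) : Op Γ)
      map_add' := fun F G => map_add tau _ _
      map_smul' := fun c F => map_smul tau c _ } 1 (fun F => by
        rw [one_mul]
        have h := norm_tau_mul_le_of_contraction (1 : vNa Γ) F ContinuousLinearMap.norm_id_le
        rw [OneMemClass.coe_one, one_mul] at h
        exact h)

/-- The trace `τ` on `L¹(vNa(Γ))`, the continuous extension of `F ↦ ⟨F δ_e, δ_e⟩`. -/
def tr : L1 Γ →L[ℂ] ℂ := trCore.fromCompletion

/-- `F ↦ G F` on `vNa(Γ)`, continuous for the trace norm. -/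
def leftMulCore (G : vNa Γ) : L1Core Γ →L[ℂ] L1Core Γ :=
  LinearMap.mkContinuous
    { toFun := fun F => (G * (show vNa Γ from F : vNa Γ) : vNa Γ)
      map_add' := fun _ _ => mul_add G _ _
      map_smul' := fun c _ => mul_smul_comm c G _ } ‖(G : Op Γ)‖ (traceNorm_mul_le G)

/-- Left multiplication `F ↦ G F` on `L¹(vNa(Γ))` by `G ∈ vNa(Γ)`, extended by continuity. -/
def leftMul (G : vNa Γ) : L1 Γ →L[ℂ] L1 Γ := (leftMulCore G).completion

/-- `F ↦ F G` on `vNa(Γ)`, continuous for the trace norm. -/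
def rightMulCore (G : vNa Γ) : L1Core Γ →L[ℂ] L1Core Γ :=
  LinearMap.mkContinuous
    { toFun := fun F => ((show vNa Γ from F : vNa Γ) * G : vNa Γ)
      map_add' := fun _ _ => add_mul _ _ G
      map_smul' := fun c _ => smul_mul_assoc c _ G } ‖(G : Op Γ)‖ (fun F => traceNorm_mul_le' F G)

/-- Right multiplication `F ↦ F G` on `L¹(vNa(Γ))` by `G ∈ vNa(Γ)`, extended by continuity. -/
def rightMul (G : vNa Γ) : L1 Γ →L[ℂ] L1 Γ := (rightMulCore G).completion

/-- `F ↦ F*` on `vNa(Γ)`, continuous for the trace norm. -/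
def adjointCore : L1Core Γ →L⋆[ℂ] L1Core Γ :=
  LinearMap.mkContinuous
    { toFun := fun F => (star (show vNa Γ from F : vNa Γ) : vNa Γ)
      map_add' := fun F G => star_add (R := vNa Γ) F G
      map_smul' := fun c F => star_smul (A := vNa Γ) c F } 1 (fun F => by
        rw [one_mul]
        exact traceNorm_star_le F)

/-- The adjoint `F ↦ F*` on `L¹(vNa(Γ))`, extended by continuity. -/
def adjoint : L1 Γ →L⋆[ℂ] L1 Γ := adjointCore.completion

instance : Star (L1 Γ) := ⟨fun F => adjoint F⟩

/-- Positivity in `L¹(vNa(Γ))`: the positive cone is the `‖·‖₁`-closure of the cone of positive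
operators of `vNa(Γ)`; as for scalar `L¹` spaces, it consists of the elements that are positive
as (possibly unbounded) operators. -/
def IsNonneg (F : L1 Γ) : Prop :=
  F ∈ closure (toL1 '' {G : vNa Γ | (G : Op Γ).IsPositive})

lemma tr_toL1 (F : vNa Γ) : tr (toL1 F) = tau (F : Op Γ) :=
  ContinuousLinearMap.fromCompletion_apply_coe _ _

lemma leftMul_toL1 (G F : vNa Γ) : leftMul G (toL1 F) = toL1 (G * F) :=
  ContinuousLinearMap.completion_apply_coe _ _

lemma rightMul_toL1 (G F : vNa Γ) : rightMul G (toL1 F) = toL1 (F * G) :=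
  ContinuousLinearMap.completion_apply_coe _ _

lemma star_toL1 (F : vNa Γ) : star (toL1 F) = toL1 (star F) :=
  ContinuousLinearMap.completion_apply_coe _ _

end L1

/-- `B` is a bracket map for the unitary representation `T`:
`⟨φ, T(γ) ψ⟩ = τ([φ, ψ] λ(γ)*)` for all `φ`, `ψ`, `γ`, where `⟨·,·⟩` is linear in its first
argument (so the arguments of Mathlib's `inner` are swapped). -/
def IsBracket {H : Type*} [NormedAddCommGroup H] [InnerProductSpace ℂ H] [CompleteSpace H]
    (T : Γ →* unitary (H →L[ℂ] H)) (B : H → H → L1 Γ) : Prop :=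
  ∀ (φ ψ : H) (γ : Γ),
    ⟪(T γ : H →L[ℂ] H) ψ, φ⟫_ℂ = L1.tr (L1.rightMul (star (lam γ)) (B φ ψ))

end L1

end GroupVN

end

/-! An element `F` of `L¹(vNa(Γ))` is determined by its Fourier coefficients `τ(F λ(γ)*)`
(`L1.ext_pair`). The bracket relation says that those of `[φ, ψ]` are `⟨φ, T(γ)ψ⟩`, so
sesquilinearity, hermitian symmetry and equivariance reduce to identities between inner products.

Injectivity of the Fourier coefficients has two ingredients. The trace norm is dual to the operator
norm, so `F = 0` once `τ(F W) = 0` for all `W` in `vNa(Γ)`. To pass from `W = λ(γ)` to all `W`, a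
form of Kaplansky density is proved (`isBoundedLimit_of_mem`): each `W` is approximated in the norm
`‖W δ_e‖` by trigonometric polynomials bounded in operator norm, and on such bounded sets `W ↦ τ(F
W)` is continuous for this norm. The approximation uses resolvents: those of self-adjoint operators
at `-i` are contractions depending on the operator in a Lipschitz way for the 2-norm, so no norm
control on the approximants of the operator itself is needed.

For positivity, `τ([ψ, ψ] a* a) = ‖∑ c_i T(γ_i)ψ‖² ≥ 0` when `a = ∑ c_i λ(γ_i)`, and density extends
the inequality to all `a` in `vNa(Γ)`. By `L1.isNonneg_of_pair`, a self-adjoint element with this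
property is positive: the negative part of a nearby self-adjoint operator must have small trace.
Finally the norm of a positive element is its trace, and the case `γ = e` gives `τ([ψ, ψ]) = ‖ψ‖²`.
-/

noncomputable section
namespace GroupVN

/-! ### Resolvents of self-adjoint elements and the function `v / (v² + 1)`. -/

section Resolvent

variable {A : Type*} [CStarAlgebra A]

/-- A self-adjoint element has a contractive resolvent at `-i`, which lies in every closed star
subalgebra containing the element. -/
lemma exists_resolvent {M : StarSubalgebra ℂ A} (hM : IsClosed (M : Set A)) {p : A}
    (hp : IsSelfAdjoint p) (hpM : p ∈ M) :
    ∃ R ∈ M, ‖R‖ ≤ 1 ∧ R * (p + Complex.I • 1) = 1 ∧ (p + Complex.I • 1) * R = 1 := by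
  have := hM
  have hn : IsStarNormal p := hp.isStarNormal
  have hre : ∀ x ∈ spectrum ℂ p, x.im = 0 := fun x hx => hp.im_eq_zero_of_mem_spectrum hx
  have hne : ∀ x ∈ spectrum ℂ p, x + Complex.I ≠ 0 := by
    intro x hx h
    have := congrArg Complex.im h
    simp [hre x hx] at this
  have hc : ContinuousOn (fun x : ℂ => (x + Complex.I)⁻¹) (spectrum ℂ p) :=
    ContinuousOn.inv₀ (by fun_prop) hne
  have hc' : ContinuousOn (fun x : ℂ => x + Complex.I) (spectrum ℂ p) := by fun_prop
  have hsum : p + Complex.I • 1 = cfc (fun x : ℂ => x + Complex.I) p := by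
    rw [cfc_add_const Complex.I (fun x : ℂ => x) p (by fun_prop), cfc_id' ℂ p,
      Algebra.algebraMap_eq_smul_one]
  refine ⟨cfc (fun x : ℂ => (x + Complex.I)⁻¹) p, cfc_mem (s := M) _ hpM, ?_, ?_, ?_⟩
  · refine norm_cfc_le zero_le_one fun x hx => ?_
    rw [norm_inv]
    refine inv_le_one_of_one_le₀ ?_
    have := Complex.abs_im_le_norm (x + Complex.I)
    simpa [hre x hx] using this
  · rw [hsum, ← cfc_mul _ _ p hc hc', ← cfc_one ℂ p]
    exact cfc_congr fun x hx => inv_mul_cancel₀ (hne x hx)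
  · rw [hsum, ← cfc_mul _ _ p hc' hc, ← cfc_one ℂ p]
    exact cfc_congr fun x hx => mul_inv_cancel₀ (hne x hx)

/-- A self-adjoint element of norm at most `1/2` has the form `V (V² + 1)⁻¹` with `V`
self-adjoint. -/
lemma exists_mul_sq_add_one_eq {M : StarSubalgebra ℂ A} (hM : IsClosed (M : Set A)) {W : A}
    (hW : IsSelfAdjoint W) (hWM : W ∈ M) (hn : ‖W‖ ≤ 1 / 2) :
    ∃ V ∈ M, IsSelfAdjoint V ∧ W * (V * V + 1) = V := by
  have := hM
  set g : ℝ → ℝ := fun y => 2 * y / (1 + √(1 - 4 * y ^ 2)) with hg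
  have hgc : Continuous g := by
    refine Continuous.div (by fun_prop) (by fun_prop) fun y => ?_
    positivity
  refine ⟨cfc g W, cfc_mem (s := M) _ hWM, cfc_predicate _ _, ?_⟩
  rw [← cfc_mul g g W, ← cfc_one ℝ W, ← cfc_add (a := W) _ _ (by fun_prop) (by fun_prop)]
  conv_lhs => arg 1; rw [← cfc_id' ℝ W]
  rw [← cfc_mul (a := W) _ _ (by fun_prop) (by simp only [Pi.one_apply]; fun_prop)]
  refine cfc_congr fun y hy => ?_
  have hy1 : ‖y‖ ≤ 1 / 2 := by
    by_cases hA : Nontrivial A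
    · exact (spectrum.norm_le_norm_of_mem hy).trans hn
    · rw [not_nontrivial_iff_subsingleton] at hA
      simp [spectrum.of_subsingleton] at hy
  rw [Real.norm_eq_abs, abs_le] at hy1
  have h0 : 0 ≤ 1 - 4 * y ^ 2 := by nlinarith
  have hs := Real.sq_sqrt h0
  have hs0 := Real.sqrt_nonneg (1 - 4 * y ^ 2)
  simp only [hg, Pi.one_apply]
  generalize √(1 - 4 * y ^ 2) = t at hs hs0
  have ht : 1 + t ≠ 0 := by positivity
  field_simp
  linear_combination y * hs

end Resolvent

/-! ### Bounded 2-norm approximation by trigonometric polynomials. -/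

section TwoNorm

variable {Γ : Type*} [Group Γ]

/-- The `2`-norm `‖F δ_e‖` of an operator. -/
def twoNorm (F : Op Γ) : ℝ := ‖F (delta 1)‖

lemma twoNorm_nonneg (F : Op Γ) : 0 ≤ twoNorm F := norm_nonneg _

lemma twoNorm_add_le (F G : Op Γ) : twoNorm (F + G) ≤ twoNorm F + twoNorm G := norm_add_le _ _

lemma twoNorm_smul (c : ℂ) (F : Op Γ) : twoNorm (c • F) = ‖c‖ * twoNorm F :=
  norm_smul c (F (delta 1))

lemma twoNorm_le_norm (F : Op Γ) : twoNorm F ≤ ‖F‖ := by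
  simpa [norm_delta, twoNorm] using F.le_opNorm (delta (1 : Γ))

lemma twoNorm_mul_le (F G : Op Γ) : twoNorm (F * G) ≤ ‖F‖ * twoNorm G := F.le_opNorm _

lemma tau_star_mul_self (F : Op Γ) : tau (star F * F) = ((twoNorm F ^ 2 : ℝ) : ℂ) := by
  rw [tau_apply, ContinuousLinearMap.star_eq_adjoint, mul_apply_eq_comp,
    ContinuousLinearMap.adjoint_inner_right, inner_self_eq_norm_sq_to_K, twoNorm]
  norm_cast

lemma norm_tau_mul_le_twoNorm (F G : Op Γ) :
    ‖tau (F * G)‖ ≤ twoNorm (star F) * twoNorm G := by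
  rw [tau_apply, mul_apply_eq_comp, ← ContinuousLinearMap.adjoint_inner_left]
  exact norm_inner_le_norm _ _

/-- Traciality: `‖F* δ_e‖² = τ(F F*) = τ(F* F) = ‖F δ_e‖²`. -/
lemma twoNorm_star {F : Op Γ} (hF : F ∈ vNa Γ) : twoNorm (star F) = twoNorm F := by
  have h := tau_star_mul_self (star F)
  rw [star_star, tau_mul_comm hF (star_mem hF), tau_star_mul_self] at h
  exact ((sq_eq_sq₀ (twoNorm_nonneg _) (twoNorm_nonneg _)).1 (by exact_mod_cast h)).symm

/-- Taking adjoints, isometric for the 2-norm on `vNa(Γ)`, turns right multiplication into left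
multiplication, where the bound is immediate. -/
lemma twoNorm_mul_le' {F G : Op Γ} (hF : F ∈ vNa Γ) (hG : G ∈ vNa Γ) :
    twoNorm (F * G) ≤ twoNorm F * ‖G‖ := by
  rw [← twoNorm_star (mul_mem hF hG), star_mul, ← twoNorm_star hF, mul_comm, ← norm_star G]
  exact twoNorm_mul_le _ _

lemma trigPoly_le_vNa {a : Op Γ} (ha : a ∈ trigPoly Γ) : a ∈ vNa Γ := isWOTLimit_of_mem ha

-- Since `λ(γ) δ_e = δ_γ`, finite partial sums of the expansion of `f` are values at `δ_e` of
-- trigonometric polynomials. Nothing is said about their operator norms.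
open scoped Classical in
lemma exists_trigPoly_apply_delta (f : Ell2 Γ) {ε : ℝ} (hε : 0 < ε) :
    ∃ a ∈ trigPoly Γ, ‖f - a (delta 1)‖ < ε := by
  have h := lp.hasSum_single (E := fun _ : Γ => ℂ) (p := 2) (by norm_num) f
  obtain ⟨s, hs⟩ := (Metric.tendsto_nhds.1 h ε hε).exists
  refine ⟨∑ γ ∈ s, f γ • leftRegular Γ γ,
    sum_mem fun γ _ => Submodule.smul_mem _ _ (Submodule.subset_span ⟨γ, rfl⟩), ?_⟩
  have : (∑ γ ∈ s, f γ • leftRegular Γ γ) (delta 1) = ∑ γ ∈ s, lp.single 2 γ (f γ) := by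
    rw [sum_apply]
    refine Finset.sum_congr rfl fun γ _ => ?_
    rw [smul_apply, leftRegular_delta, mul_one, delta, ← lp.single_smul,
      smul_eq_mul, mul_one]
  rw [this, ← dist_eq_norm, dist_comm]
  exact hs

lemma exists_selfAdjoint_trigPoly {W : Op Γ} (hW : W ∈ vNa Γ) (hsa : IsSelfAdjoint W)
    {ε : ℝ} (hε : 0 < ε) : ∃ p ∈ trigPoly Γ, IsSelfAdjoint p ∧ twoNorm (W - p) < ε := by
  obtain ⟨a, ha, h⟩ := exists_trigPoly_apply_delta (W (delta 1)) hε
  have h1 : twoNorm (W - a) < ε := h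
  have h2 : twoNorm (W - star a) < ε := by
    have : W - star a = star (W - a) := by rw [star_sub, hsa.star_eq]
    rwa [this, twoNorm_star (sub_mem hW (trigPoly_le_vNa ha))]
  refine ⟨(1 / 2 : ℂ) • (a + star a),
    Submodule.smul_mem _ _ (add_mem ha (trigPoly_star ha)), ?_, ?_⟩
  · rw [IsSelfAdjoint, star_smul, star_add, star_star, add_comm]
    simp
  · have : W - (1 / 2 : ℂ) • (a + star a) = (1 / 2 : ℂ) • ((W - a) + (W - star a)) := by
      module
    rw [this, twoNorm_smul]
    have := twoNorm_add_le (W - a) (W - star a)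
    norm_num
    linarith

variable (Γ) in
/-- Trigonometric polynomials as a star subalgebra. -/
def trigAlg : StarSubalgebra ℂ (Op Γ) where
  carrier := trigPoly Γ
  mul_mem' := trigPoly_mul
  add_mem' := add_mem
  algebraMap_mem' c := by
    rw [Algebra.algebraMap_eq_smul_one, ← map_one (leftRegular Γ)]
    exact Submodule.smul_mem _ _ (Submodule.subset_span ⟨1, rfl⟩)
  star_mem' := trigPoly_star

/-- Approximability in `2`-norm by an operator-norm bounded set of trigonometric polynomials. -/
def IsBoundedLimit (W : Op Γ) : Prop :=
  ∃ C : ℝ, ∀ ε : ℝ, 0 < ε → ∃ a ∈ trigPoly Γ, ‖a‖ ≤ C ∧ twoNorm (W - a) < ε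

lemma IsBoundedLimit.add {V W : Op Γ} (hV : IsBoundedLimit V) (hW : IsBoundedLimit W) :
    IsBoundedLimit (V + W) := by
  obtain ⟨C, hC⟩ := hV
  obtain ⟨D, hD⟩ := hW
  refine ⟨C + D, fun ε hε => ?_⟩
  obtain ⟨a, ha, ha1, ha2⟩ := hC (ε / 2) (by positivity)
  obtain ⟨b, hb, hb1, hb2⟩ := hD (ε / 2) (by positivity)
  refine ⟨a + b, add_mem ha hb, (norm_add_le _ _).trans (add_le_add ha1 hb1), ?_⟩
  rw [add_sub_add_comm]
  linarith [twoNorm_add_le (V - a) (W - b)]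

lemma IsBoundedLimit.smul {W : Op Γ} (hW : IsBoundedLimit W) (c : ℂ) :
    IsBoundedLimit (c • W) := by
  obtain ⟨C, hC⟩ := hW
  refine ⟨‖c‖ * C, fun ε hε => ?_⟩
  obtain ⟨a, ha, ha1, ha2⟩ := hC (ε / (‖c‖ + 1)) (by positivity)
  refine ⟨c • a, Submodule.smul_mem _ _ ha, ?_, ?_⟩
  · rw [norm_smul]
    gcongr
  · rw [← smul_sub, twoNorm_smul]
    rw [lt_div_iff₀ (by positivity)] at ha2
    nlinarith [twoNorm_nonneg (W - a)]

lemma IsBoundedLimit.star {W : Op Γ} (hW : IsBoundedLimit W) (hM : W ∈ vNa Γ) :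
    IsBoundedLimit (star W) := by
  obtain ⟨C, hC⟩ := hW
  refine ⟨C, fun ε hε => ?_⟩
  obtain ⟨a, ha, ha1, ha2⟩ := hC ε hε
  refine ⟨Star.star a, trigPoly_star ha, (norm_star a).trans_le ha1, ?_⟩
  rwa [← star_sub, twoNorm_star (sub_mem hM (trigPoly_le_vNa ha))]

/-- Approximate `V` in 2-norm by a self-adjoint trigonometric polynomial `p`, possibly of huge
operator norm; the resolvent of `p` is still a contraction and is 2-norm close to `R`. -/
lemma isBoundedLimit_resolvent {V R : Op Γ} (hV : V ∈ vNa Γ) (hsa : IsSelfAdjoint V)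
    (hR : R ∈ vNa Γ) (hn : ‖R‖ ≤ 1) (h2 : (V + Complex.I • 1) * R = 1) :
    IsBoundedLimit R := by
  -- The bound `2` is `1` for the contraction `S` plus an operator-norm error below `1`.
  refine ⟨2, fun ε hε => ?_⟩
  obtain ⟨p, hp, hpsa, hVp⟩ := exists_selfAdjoint_trigPoly hV hsa (ε := ε / 2) (by positivity)
  -- The resolvent of `p` is taken in the norm closure of the trigonometric polynomials, so it can
  -- be replaced by a polynomial `a` at small operator-norm cost.
  obtain ⟨S, hS, hS1, hS2, -⟩ := exists_resolvent
    (trigAlg Γ).isClosed_topologicalClosure hpsa ((trigAlg Γ).le_topologicalClosure hp)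
  obtain ⟨a, ha, haS⟩ := Metric.mem_closure_iff.1 hS (min (ε / 2) 1) (by positivity)
  rw [dist_eq_norm] at haS
  have haS1 : ‖S - a‖ < ε / 2 := haS.trans_le (min_le_left _ _)
  have haS2 : ‖S - a‖ < 1 := haS.trans_le (min_le_right _ _)
  refine ⟨a, ha, ?_, ?_⟩
  · have := norm_sub_norm_le a S
    rw [norm_sub_rev] at this
    linarith
  · have h3 : R - S = S * ((p - V) * R) := by
      have : p - V = (p + Complex.I • 1) - (V + Complex.I • 1) := by abel
      rw [this, sub_mul, h2, mul_sub, ← mul_assoc, hS2, one_mul, mul_one]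
    have hpV : p - V ∈ vNa Γ := sub_mem (trigPoly_le_vNa hp) hV
    have h4 : twoNorm (p - V) = twoNorm (V - p) := norm_sub_rev _ _
    have h5 : twoNorm (R - S) ≤ twoNorm (V - p) := by
      rw [h3, ← h4]
      refine (twoNorm_mul_le _ _).trans ?_
      refine (mul_le_of_le_one_left (twoNorm_nonneg _) hS1).trans ?_
      refine (twoNorm_mul_le' hpV hR).trans ?_
      exact mul_le_of_le_one_right (twoNorm_nonneg _) hn
    have h6 := twoNorm_add_le (R - S) (S - a)
    rw [sub_add_sub_cancel] at h6
    linarith [twoNorm_le_norm (S - a)]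

/-- Partial fractions: `W = V (V² + 1)⁻¹` is half the sum of the resolvent `R = (V + i)⁻¹` and its
adjoint `(V - i)⁻¹`. -/
lemma isBoundedLimit_of_isSelfAdjoint {W : Op Γ} (hW : W ∈ vNa Γ) (hsa : IsSelfAdjoint W)
    (hn : ‖W‖ ≤ 1 / 2) : IsBoundedLimit W := by
  obtain ⟨V, hV, hVsa, hWV⟩ := exists_mul_sq_add_one_eq isClosed_vNa hsa hW hn
  obtain ⟨R, hR, hR1, hR2, hR3⟩ := exists_resolvent isClosed_vNa hVsa hV
  have hs : star (V + Complex.I • (1 : Op Γ)) = V - Complex.I • 1 := by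
    rw [star_add, hVsa.star_eq, star_smul, star_one]
    simp [sub_eq_add_neg]
  have hR4 : star R * (V - Complex.I • 1) = 1 := by
    rw [← hs, ← star_mul, hR3, star_one]
  have hR5 : (V - Complex.I • 1) * star R = 1 := by
    rw [← hs, ← star_mul, hR2, star_one]
  have hII : (Complex.I • (1 : Op Γ)) * (Complex.I • 1) = -1 := by
    rw [smul_mul_smul_comm, Complex.I_mul_I, one_mul, neg_smul, one_smul]
  have hcom : V * (Complex.I • (1 : Op Γ)) = (Complex.I • 1) * V := by simp
  have hsq : V * V + 1 = (V - Complex.I • 1) * (V + Complex.I • 1) := by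
    rw [sub_mul, mul_add, mul_add, hII, hcom]; abel
  have hsq' : V * V + 1 = (V + Complex.I • 1) * (V - Complex.I • 1) := by
    rw [add_mul, mul_sub, mul_sub, hII, hcom]; abel
  have key : W = (1 / 2 : ℂ) • (R + star R) := by
    have h1 : (R + star R) * (V * V + 1) = (2 : ℂ) • V := by
      rw [add_mul]
      conv_lhs => arg 1; rw [hsq', ← mul_assoc, hR2, one_mul]
      rw [hsq, ← mul_assoc, hR4, one_mul]
      module
    have h2 : W * (V * V + 1) = ((1 / 2 : ℂ) • (R + star R)) * (V * V + 1) := by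
      rw [smul_mul_assoc, h1, hWV]
      module
    -- Right multiplication by `R` and then `R*` cancels `V² + 1`.
    have h3 := congrArg (fun X => X * R * star R) h2
    have h4 : (V * V + 1) * R * star R = 1 := by
      rw [hsq, mul_assoc _ _ R, hR3, mul_one, hR5]
    simpa only [mul_assoc _ (V * V + 1) R, mul_assoc _ ((V * V + 1) * R), h4, mul_one]
      using h3
  have hRl := isBoundedLimit_resolvent hV hVsa hR hR1 hR3
  rw [key]
  exact (hRl.add (hRl.star hR)).smul _

/-- Every element of the group von Neumann algebra is a `2`-norm limit of an operator-norm bounded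
sequence of trigonometric polynomials. -/
theorem isBoundedLimit_of_mem {W : Op Γ} (hW : W ∈ vNa Γ) : IsBoundedLimit W := by
  have hsa : ∀ X ∈ vNa Γ, IsSelfAdjoint X → IsBoundedLimit X := by
    intro X hX hXs
    -- This scale makes `‖r⁻¹ X‖ ≤ 1/2` and stays nonzero when `X = 0`.
    set r : ℝ := 2 * ‖X‖ + 1 with hr
    have hr0 : 0 < r := by positivity
    have h : IsBoundedLimit (((r⁻¹ : ℝ) : ℂ) • X) := by
      refine isBoundedLimit_of_isSelfAdjoint ((vNa Γ).smul_mem hX _) ?_ ?_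
      · rw [IsSelfAdjoint, star_smul, hXs.star_eq]
        simp
      · rw [norm_smul, Complex.norm_real, Real.norm_of_nonneg (by positivity),
          inv_mul_le_iff₀ hr0, hr]
        linarith
    have h2 := h.smul (r : ℂ)
    rwa [smul_smul, ← Complex.ofReal_mul, mul_inv_cancel₀ hr0.ne', Complex.ofReal_one,
      one_smul] at h2
  have h1 := hsa _ (add_mem hW (star_mem hW)) (IsSelfAdjoint.add_star_self W)
  have h2 := hsa (Complex.I • (W - star W)) ((vNa Γ).smul_mem (sub_mem hW (star_mem hW)) _) (by
    rw [IsSelfAdjoint, star_smul, star_sub, star_star, RCLike.star_def, Complex.conj_I]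
    module)
  have h3 : W = (1 / 2 : ℂ) • ((W + star W) + (-Complex.I) • (Complex.I • (W - star W))) := by
    rw [smul_smul, neg_mul, Complex.I_mul_I]
    module
  rw [h3]
  exact (h1.add (h2.smul _)).smul _

end TwoNorm

/-! ### Square roots and negative parts of operators. -/

section Operators

variable {H : Type*} [NormedAddCommGroup H] [InnerProductSpace ℂ H] [CompleteSpace H]
  {M : StarSubalgebra ℂ (H →L[ℂ] H)}

lemma opAbs_of_nonneg {F : H →L[ℂ] H} (hF : 0 ≤ F) : opAbs F = F := CFC.abs_of_nonneg F hF

lemma norm_star_mul_self_eq (F : H →L[ℂ] H) : ‖star F * F‖ = ‖F‖ * ‖F‖ :=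
  CStarRing.norm_star_mul_self

lemma exists_star_mul_self_eq (hM : IsClosed (M : Set (H →L[ℂ] H))) {E : H →L[ℂ] H}
    (hE : 0 ≤ E) (hEM : E ∈ M) : ∃ S ∈ M, star S * S = E :=
  ⟨CFC.sqrt E, sqrt_mem hM hE hEM, by
    rw [(CFC.sqrt_nonneg E).isSelfAdjoint.star_eq, CFC.sqrt_mul_sqrt_self E hE]⟩

/-- A self-adjoint operator `G` is a difference `P - N` of positive operators, with `N` close to
`-G E` for some `0 ≤ E ≤ 1`. -/
lemma exists_neg_part (hM : IsClosed (M : Set (H →L[ℂ] H))) {G : H →L[ℂ] H}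
    (hG : IsSelfAdjoint G) (hGM : G ∈ M) {ε : ℝ} (hε : 0 < ε) :
    ∃ P ∈ M, ∃ N ∈ M, ∃ E ∈ M, 0 ≤ P ∧ 0 ≤ N ∧ 0 ≤ E ∧ ‖E‖ ≤ 1 ∧
      G = P - N ∧ ‖N + G * E‖ ≤ ε := by
  have := hM
  have hmem : ∀ f : ℝ → ℝ, cfc f G ∈ M := fun f => cfc_mem (s := M) f hGM
  set n : ℝ → ℝ := fun x => max (-x) 0 with hn
  -- A continuous substitute for the indicator of the negative half-line, so that `E` stays in the
  -- norm-closed algebra. The error is `n x + x e(x) = ε e(x) ≤ ε`.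
  set e : ℝ → ℝ := fun x => n x / (n x + ε) with he
  have hn0 : ∀ x, 0 ≤ n x := fun x => le_max_right _ _
  have hnc : Continuous n := by fun_prop
  have hne : ∀ x, n x + ε ≠ 0 := fun x => by have := hn0 x; positivity
  have hec : Continuous e := hnc.div (by fun_prop) hne
  refine ⟨_, hmem fun x => max x 0, _, hmem n, _, hmem e,
    cfc_nonneg fun x _ => le_max_right _ _, cfc_nonneg fun x _ => hn0 x,
    cfc_nonneg fun x _ => div_nonneg (hn0 x) (add_nonneg (hn0 x) hε.le), ?_, ?_, ?_⟩
  · refine norm_cfc_le zero_le_one fun x _ => ?_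
    have := hn0 x
    rw [Real.norm_of_nonneg (by positivity), div_le_one (by positivity)]
    linarith
  · rw [← cfc_sub (a := G) _ _ (by fun_prop) (by fun_prop)]
    conv_lhs => rw [← cfc_id' ℝ G]
    refine cfc_congr fun x _ => ?_
    rcases le_total x 0 with h | h
    · simp [hn, h]
    · simp [hn, h]
  · conv_lhs => arg 1; arg 2; arg 1; rw [← cfc_id' ℝ G]
    rw [← cfc_mul (a := G) _ _ (by fun_prop) (by fun_prop),
      ← cfc_add (a := G) _ _ (by fun_prop) (by fun_prop)]
    refine norm_cfc_le hε.le fun x _ => ?_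
    have h0 := hn0 x
    have h1 : n x + x * e x = ε * e x := by
      rcases le_total x 0 with h | h
      · have h2 : n x = -x := max_eq_left (by linarith)
        have h3 := hne x
        simp only [he]
        rw [h2] at h3 ⊢
        field_simp
        ring
      · have h2 : n x = 0 := max_eq_right (by linarith)
        simp [he, h2]
    rw [h1, Real.norm_of_nonneg (by positivity)]
    refine mul_le_of_le_one_right hε.le ?_
    rw [div_le_one (by positivity)]
    linarith

end Operators

/-! ### The pairing of `L¹(vNa(Γ))` with `vNa(Γ)`. -/

section L1

variable {Γ : Type*} [Group Γ]

namespace L1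

lemma induction {p : L1 Γ → Prop} (F : L1 Γ) (hc : IsClosed {F | p F})
    (h : ∀ G : vNa Γ, p (toL1 G)) : p F :=
  UniformSpace.Completion.induction_on F hc h

lemma toL1_add (F G : vNa Γ) : toL1 (F + G) = toL1 F + toL1 G :=
  UniformSpace.Completion.coe_add (α := L1Core Γ) F G

lemma toL1_sub (F G : vNa Γ) : toL1 (F - G) = toL1 F - toL1 G :=
  UniformSpace.Completion.coe_sub (α := L1Core Γ) F G

lemma toL1_smul (c : ℂ) (F : vNa Γ) : toL1 (c • F) = c • toL1 F :=
  UniformSpace.Completion.coe_smul (X := L1Core Γ) c F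

lemma norm_toL1_eq_traceNorm (F : vNa Γ) : ‖toL1 F‖ = traceNorm F := norm_toL1 F

lemma exists_norm_sub_toL1_lt (F : L1 Γ) {ε : ℝ} (hε : 0 < ε) :
    ∃ G : vNa Γ, ‖F - toL1 G‖ < ε := by
  obtain ⟨G, hG⟩ := (UniformSpace.Completion.denseRange_coe (α := L1Core Γ)).exists_dist_lt F hε
  exact ⟨G, by rwa [dist_eq_norm] at hG⟩

/-- The pairing `τ(F W)` of `F ∈ L¹(vNa(Γ))` and `W ∈ vNa(Γ)`. -/
def pair (F : L1 Γ) (W : vNa Γ) : ℂ := tr (rightMul W F)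

lemma pair_toL1 (F W : vNa Γ) : pair (toL1 F) W = tau ((F : Op Γ) * (W : Op Γ)) := by
  rw [pair, rightMul_toL1, tr_toL1, MulMemClass.coe_mul]

lemma continuous_pair (W : vNa Γ) : Continuous fun F : L1 Γ => pair F W :=
  tr.continuous.comp (rightMul W).continuous

lemma pair_add_left (F G : L1 Γ) (W : vNa Γ) : pair (F + G) W = pair F W + pair G W := by
  simp only [pair, map_add]

lemma pair_sub_left (F G : L1 Γ) (W : vNa Γ) : pair (F - G) W = pair F W - pair G W := by
  simp only [pair, map_sub]

lemma pair_smul_left (c : ℂ) (F : L1 Γ) (W : vNa Γ) : pair (c • F) W = c * pair F W := by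
  simp only [pair, map_smul, smul_eq_mul]

lemma pair_add (F : L1 Γ) (V W : vNa Γ) : pair F (V + W) = pair F V + pair F W := by
  refine induction F (isClosed_eq (continuous_pair _)
    ((continuous_pair _).add (continuous_pair _))) fun G => ?_
  change pair (toL1 G) (V + W) = pair (toL1 G) V + pair (toL1 G) W
  rw [pair_toL1, pair_toL1, pair_toL1, AddMemClass.coe_add, mul_add, map_add]

lemma pair_smul (F : L1 Γ) (c : ℂ) (W : vNa Γ) : pair F (c • W) = c * pair F W := by
  refine induction F (isClosed_eq (continuous_pair _)
    (continuous_const.mul (continuous_pair _))) fun G => ?_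
  change pair (toL1 G) (c • W) = c * pair (toL1 G) W
  rw [pair_toL1, pair_toL1, SetLike.val_smul, mul_smul_comm, map_smul, smul_eq_mul]

/-- The pairing with a fixed `F` as a linear functional on `vNa(Γ)`. -/
def pairLin (F : L1 Γ) : vNa Γ →ₗ[ℂ] ℂ where
  toFun := pair F
  map_add' := pair_add F
  map_smul' := pair_smul F

lemma pairLin_apply (F : L1 Γ) (W : vNa Γ) : pairLin F W = pair F W := rfl

lemma pair_sub (F : L1 Γ) (V W : vNa Γ) : pair F (V - W) = pair F V - pair F W :=
  map_sub (pairLin F) V W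

lemma norm_pair_le (F : L1 Γ) (W : vNa Γ) : ‖pair F W‖ ≤ ‖(W : Op Γ)‖ * ‖F‖ := by
  refine induction F (isClosed_le (continuous_pair _).norm
    (continuous_const.mul continuous_norm)) fun G => ?_
  change ‖pair (toL1 G) W‖ ≤ ‖(W : Op Γ)‖ * ‖toL1 G‖
  rw [pair_toL1, norm_toL1_eq_traceNorm, tau_mul_comm G.2 W.2]
  exact norm_tau_mul_le W G

lemma pair_rightMul (F : L1 Γ) (V W : vNa Γ) : pair (rightMul V F) W = pair F (V * W) := by
  refine induction F (isClosed_eq ((continuous_pair _).comp (rightMul V).continuous)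
    (continuous_pair _)) fun G => ?_
  change pair (rightMul V (toL1 G)) W = pair (toL1 G) (V * W)
  rw [rightMul_toL1, pair_toL1, pair_toL1, MulMemClass.coe_mul, MulMemClass.coe_mul, mul_assoc]

lemma pair_leftMul (F : L1 Γ) (V W : vNa Γ) : pair (leftMul V F) W = pair F (W * V) := by
  refine induction F (isClosed_eq ((continuous_pair _).comp (leftMul V).continuous)
    (continuous_pair _)) fun G => ?_
  change pair (leftMul V (toL1 G)) W = pair (toL1 G) (W * V)
  rw [leftMul_toL1, pair_toL1, pair_toL1, MulMemClass.coe_mul, MulMemClass.coe_mul, mul_assoc,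
    tau_mul_comm V.2 (mul_mem G.2 W.2), mul_assoc]

lemma continuous_star : Continuous fun F : L1 Γ => star F := adjoint.continuous

lemma star_sub (F G : L1 Γ) : star (F - G) = star F - star G := map_sub adjoint F G

lemma pair_star (F : L1 Γ) (W : vNa Γ) : pair (star F) W = conj (pair F (star W)) := by
  refine induction F (isClosed_eq ((continuous_pair _).comp continuous_star)
    (Complex.continuous_conj.comp (continuous_pair _))) fun G => ?_
  change pair (star (toL1 G)) W = conj (pair (toL1 G) (star W))
  rw [star_toL1, pair_toL1, pair_toL1, ← tau_star, star_mul]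
  change tau (star (G : Op Γ) * (W : Op Γ)) = tau (star (star (W : Op Γ)) * star (G : Op Γ))
  rw [star_star, tau_mul_comm (star_mem G.2) W.2]

lemma norm_star_le (F : L1 Γ) : ‖star F‖ ≤ ‖F‖ := by
  refine induction F (isClosed_le continuous_star.norm continuous_norm) fun G => ?_
  rw [star_toL1, norm_toL1_eq_traceNorm, norm_toL1_eq_traceNorm]
  exact traceNorm_star_le G

/-- An element of `L¹(vNa(Γ))` annihilating the group von Neumann algebra vanishes. -/
lemma eq_zero_of_pair_eq_zero {F : L1 Γ} (h : ∀ W, pair F W = 0) : F = 0 := by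
  refine norm_eq_zero.1 (le_antisymm (le_of_forall_pos_le_add fun ε hε => ?_) (norm_nonneg _))
  obtain ⟨G, hG⟩ := exists_norm_sub_toL1_lt F (ε := ε / 2) (by positivity)
  have h1 : ‖toL1 G‖ ≤ ε / 2 := by
    rw [norm_toL1_eq_traceNorm]
    refine traceNorm_le fun W hW => ?_
    -- As `F` pairs to zero, `G` pairs like `-(F - G)`, which is small against contractions; by
    -- duality this bounds the trace norm of `G`.
    have h2 : tau ((W : Op Γ) * (G : Op Γ)) = -pair (F - toL1 G) W := by
      rw [pair_sub_left, h, pair_toL1, tau_mul_comm W.2 G.2]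
      ring
    rw [h2, norm_neg]
    refine (norm_pair_le _ _).trans ?_
    exact (mul_le_of_le_one_left (norm_nonneg _) hW).trans hG.le
  have h3 := norm_add_le (F - toL1 G) (toL1 G)
  rw [sub_add_cancel] at h3
  linarith

/-- The pairing with `F` is continuous for the `2`-norm on operator-norm bounded sets. -/
lemma norm_pair_lt {F : L1 Γ} (C : ℝ) {ε : ℝ} (hε : 0 < ε) :
    ∃ δ > 0, ∀ W : vNa Γ, ‖(W : Op Γ)‖ ≤ C → twoNorm (W : Op Γ) < δ → ‖pair F W‖ < ε := by
  -- Split `F = (F - G) + G`: the first piece is controlled by the operator-norm bound `C`, the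
  -- second by Cauchy–Schwarz for the 2-norm.
  obtain ⟨G, hG⟩ := exists_norm_sub_toL1_lt F (ε := ε / 2 / (|C| + 1)) (by positivity)
  have hG0 := twoNorm_nonneg (star (G : Op Γ))
  refine ⟨ε / 2 / (twoNorm (star (G : Op Γ)) + 1), by positivity, fun W hC hW => ?_⟩
  have h1 : pair F W = pair (F - toL1 G) W + pair (toL1 G) W := by
    rw [← pair_add_left, sub_add_cancel]
  have h2 : ‖pair (F - toL1 G) W‖ < ε / 2 := by
    rw [lt_div_iff₀ (by positivity)] at hG
    refine (norm_pair_le _ _).trans_lt ?_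
    refine lt_of_le_of_lt ?_ hG
    rw [mul_comm]
    gcongr
    exact (hC.trans (le_abs_self C)).trans (by linarith)
  have h3 : ‖pair (toL1 G) W‖ ≤ ε / 2 := by
    rw [lt_div_iff₀ (by positivity)] at hW
    rw [pair_toL1]
    refine (norm_tau_mul_le_twoNorm _ _).trans ?_
    nlinarith [twoNorm_nonneg (W : Op Γ)]
  rw [h1]
  linarith [norm_add_le (pair (F - toL1 G) W) (pair (toL1 G) W)]

/-- `τ(F W)` and `τ(F W* W)` are approximated by their values at trigonometric polynomials. -/
lemma exists_approx (F : L1 Γ) (W : vNa Γ) {ε : ℝ} (hε : 0 < ε) :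
    ∃ a : vNa Γ, (a : Op Γ) ∈ trigPoly Γ ∧ ‖pair F W - pair F a‖ < ε ∧
      ‖pair F (star W * W) - pair F (star a * a)‖ < ε := by
  obtain ⟨C, hC⟩ := isBoundedLimit_of_mem W.2
  have hC0 : 0 ≤ C := by
    obtain ⟨a, -, ha, -⟩ := hC 1 one_pos
    exact (norm_nonneg a).trans ha
  set w := ‖(W : Op Γ)‖ with hw
  have hw0 : 0 ≤ w := norm_nonneg _
  obtain ⟨δ, hδ, h1⟩ := norm_pair_lt (F := F) (w + C) hε
  obtain ⟨η, hη, h2⟩ := norm_pair_lt (F := F) (w * w + C * C) hε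
  obtain ⟨a, ha, haC, hWa⟩ := hC (min δ (η / (w + C + 1))) (by positivity)
  have haM := trigPoly_le_vNa ha
  refine ⟨⟨a, haM⟩, ha, ?_, ?_⟩
  · rw [← pair_sub]
    refine h1 _ ?_ (hWa.trans_le (min_le_left _ _))
    exact (norm_sub_le (W : Op Γ) a).trans (by gcongr)
  · rw [← pair_sub]
    have hd : twoNorm ((W : Op Γ) - a) < η / (w + C + 1) := hWa.trans_le (min_le_right _ _)
    rw [lt_div_iff₀ (by positivity)] at hd
    refine h2 _ ?_ ?_
    · change ‖star (W : Op Γ) * (W : Op Γ) - star a * a‖ ≤ _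
      refine (norm_sub_le _ _).trans ?_
      rw [norm_star_mul_self_eq, norm_star_mul_self_eq]
      gcongr
    · change twoNorm (star (W : Op Γ) * (W : Op Γ) - star a * a) < _
      -- This telescoping has 2-norm at most `(w + C) ‖(W - a) δ_e‖`, whence the tolerance `η / (w +
      -- C + 1)`.
      have h3 : star (W : Op Γ) * (W : Op Γ) - star a * a
          = star (W : Op Γ) * ((W : Op Γ) - a) + star ((W : Op Γ) - a) * a := by
        rw [_root_.star_sub, mul_sub, sub_mul, sub_add_sub_cancel]
      have hsub : (W : Op Γ) - a ∈ vNa Γ := sub_mem W.2 haM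
      have h4 := twoNorm_mul_le (star (W : Op Γ)) ((W : Op Γ) - a)
      have h5 := twoNorm_mul_le' (star_mem hsub) haM
      rw [twoNorm_star hsub] at h5
      have h6 : ‖star (W : Op Γ)‖ = w := norm_star (W : Op Γ)
      rw [h6] at h4
      rw [h3]
      refine (twoNorm_add_le _ _).trans_lt ?_
      nlinarith [twoNorm_nonneg ((W : Op Γ) - a)]

/-- Vanishing on the `λ(γ)` extends by linearity to trigonometric polynomials, then to `vNa(Γ)` by
bounded 2-norm approximation. -/
lemma pair_eq_zero_of_lam {F : L1 Γ} (h : ∀ γ, pair F (lam γ) = 0) (W : vNa Γ) :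
    pair F W = 0 := by
  have htrig : ∀ a : Op Γ, ∀ ha : a ∈ trigPoly Γ, pair F ⟨a, trigPoly_le_vNa ha⟩ = 0 := by
    intro a ha
    induction ha using Submodule.span_induction with
    | mem x hx =>
      obtain ⟨γ, rfl⟩ := hx
      exact h γ
    | zero => exact map_zero (pairLin F)
    | add x y hx hy h1 h2 =>
      exact (pair_add F ⟨x, trigPoly_le_vNa hx⟩ ⟨y, trigPoly_le_vNa hy⟩).trans (by
        rw [h1, h2, add_zero])
    | smul c x hx h1 =>
      exact (pair_smul F c ⟨x, trigPoly_le_vNa hx⟩).trans (by rw [h1, mul_zero])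
  refine norm_eq_zero.1 (le_antisymm (le_of_forall_pos_le_add fun ε hε => ?_) (norm_nonneg _))
  obtain ⟨a, ha, h1, -⟩ := exists_approx F W hε
  rw [htrig a ha, sub_zero] at h1
  linarith

lemma star_lam (γ : Γ) : star (lam γ) = lam γ⁻¹ := Subtype.ext (star_leftRegular γ)

lemma lam_mul (γ γ' : Γ) : lam γ * lam γ' = lam (γ * γ') :=
  Subtype.ext (map_mul (leftRegular Γ) γ γ').symm

/-- Elements of `L¹(vNa(Γ))` are determined by their Fourier coefficients. -/
theorem ext_pair {F G : L1 Γ} (h : ∀ γ, pair F (star (lam γ)) = pair G (star (lam γ))) :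
    F = G := by
  refine sub_eq_zero.1 (eq_zero_of_pair_eq_zero (pair_eq_zero_of_lam fun γ => ?_))
  have := h γ⁻¹
  rw [star_lam, inv_inv] at this
  rw [pair_sub_left, this, sub_self]

/-! ### Positive elements of `L¹(vNa(Γ))`. -/

/-- Positivity of the pairing with `a* a` passes from trigonometric polynomials to `vNa(Γ)`. -/
lemma pair_star_mul_self_nonneg {F : L1 Γ}
    (h : ∀ a : vNa Γ, (a : Op Γ) ∈ trigPoly Γ → 0 ≤ (pair F (star a * a)).re) (W : vNa Γ) :
    0 ≤ (pair F (star W * W)).re := by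
  refine le_of_forall_pos_le_add fun ε hε => ?_
  obtain ⟨a, ha, -, h1⟩ := exists_approx F W hε
  have h2 := (Complex.abs_re_le_norm _).trans_lt h1
  rw [Complex.sub_re, abs_lt] at h2
  linarith [h a ha]

lemma traceNorm_of_nonneg {F : vNa Γ} (hF : 0 ≤ (F : Op Γ)) :
    traceNorm F = (tau (F : Op Γ)).re := by
  rw [traceNorm, opAbs_of_nonneg hF]

/-- Both sides are continuous, and `|G| = G` for a positive operator `G`. -/
lemma norm_eq_of_isNonneg {F : L1 Γ} (hF : IsNonneg F) : ‖F‖ = (tr F).re := by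
  have hc : IsClosed {F : L1 Γ | ‖F‖ = (tr F).re} :=
    isClosed_eq continuous_norm (Complex.continuous_re.comp tr.continuous)
  refine (closure_minimal ?_ hc) hF
  rintro _ ⟨G, hG, rfl⟩
  change ‖toL1 G‖ = (tr (toL1 G)).re
  rw [norm_toL1_eq_traceNorm, tr_toL1,
    traceNorm_of_nonneg ((ContinuousLinearMap.nonneg_iff_isPositive _).2 hG)]

lemma pair_re_nonneg {F : L1 Γ} (h : ∀ W : vNa Γ, 0 ≤ (pair F (star W * W)).re)
    {E : vNa Γ} (hE : 0 ≤ (E : Op Γ)) : 0 ≤ (pair F E).re := by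
  obtain ⟨S, hS, hSE⟩ := exists_star_mul_self_eq isClosed_vNa hE E.2
  rw [show E = star ⟨S, hS⟩ * ⟨S, hS⟩ from Subtype.ext hSE.symm]
  exact h _

/-- A self-adjoint element of `L¹(vNa(Γ))` that pairs positively with all `W* W` is positive. -/
theorem isNonneg_of_pair {F : L1 Γ} (hs : star F = F)
    (h : ∀ W : vNa Γ, 0 ≤ (pair F (star W * W)).re) : IsNonneg F := by
  refine Metric.mem_closure_iff.2 fun ε hε => ?_
  obtain ⟨G', hG'⟩ := exists_norm_sub_toL1_lt F (ε := ε / 3) (by positivity)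
  -- Symmetrising the approximant makes it self-adjoint without increasing the error, because `F* =
  -- F` and the adjoint does not increase the norm.
  set G : vNa Γ := (1 / 2 : ℂ) • (G' + star G') with hGdef
  have hGsa : IsSelfAdjoint (G : Op Γ) := by
    change star ((1 / 2 : ℂ) • ((G' : Op Γ) + star (G' : Op Γ)))
      = (1 / 2 : ℂ) • ((G' : Op Γ) + star (G' : Op Γ))
    rw [star_smul, star_add, star_star, add_comm]
    simp
  have hFG : ‖F - toL1 G‖ < ε / 3 := by
    have h1 : F - toL1 G = (1 / 2 : ℂ) • ((F - toL1 G') + star (F - toL1 G')) := by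
      rw [star_sub, hs, star_toL1, hGdef, toL1_smul, toL1_add]
      module
    have h2 := norm_add_le (F - toL1 G') (star (F - toL1 G'))
    have h3 := norm_star_le (F - toL1 G')
    rw [h1, norm_smul]
    norm_num
    linarith
  obtain ⟨P, hPM, N, hNM, E, hEM, hP, hN, hE, hE1, hGPN, hNE⟩ :=
    exists_neg_part isClosed_vNa hGsa G.2 (ε := ε / 3) (by positivity)
  lift P to vNa Γ using hPM
  lift N to vNa Γ using hNM
  lift E to vNa Γ using hEM
  replace hGPN : G = P - N := Subtype.ext hGPN
  refine ⟨toL1 P, ⟨P, (ContinuousLinearMap.nonneg_iff_isPositive _).1 hP, rfl⟩, ?_⟩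
  -- Up to `ε / 3`, `τ(N)` is the real part of `-τ(G E) = τ((F - G) E) - τ(F E)`. The first term
  -- contributes less than `ε / 3`, and the second is nonpositive by hypothesis.
  have hN1 : ‖toL1 N‖ < ε / 3 + ε / 3 := by
    rw [norm_toL1_eq_traceNorm, traceNorm_of_nonneg hN]
    have h1 := pair_re_nonneg h hE
    have h2 : (pair F E).re = (pair (F - toL1 G) E).re + (tau ((G : Op Γ) * (E : Op Γ))).re := by
      rw [← pair_toL1, ← Complex.add_re, ← pair_add_left, sub_add_cancel]
    have h3 : (pair (F - toL1 G) E).re < ε / 3 :=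
      ((Complex.re_le_norm _).trans (norm_pair_le _ _)).trans_lt
        ((mul_le_of_le_one_left (norm_nonneg _) hE1).trans_lt hFG)
    have h4 := ((Complex.re_le_norm _).trans (norm_tau_le _)).trans hNE
    rw [map_add, Complex.add_re] at h4
    linarith
  have h5 : F - toL1 P = (F - toL1 G) - toL1 N := by
    rw [hGPN, toL1_sub]
    abel
  rw [dist_eq_norm, h5]
  linarith [norm_sub_le (F - toL1 G) (toL1 N)]

end L1

end L1

/-! ### Symmetry, positivity and norm of the bracket. -/

section Bracket

variable {Γ : Type*} [Group Γ]
  {H : Type*} [NormedAddCommGroup H] [InnerProductSpace ℂ H] [CompleteSpace H]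
  {T : Γ →* unitary (H →L[ℂ] H)} {B : H → H → L1 Γ}

lemma inner_unitary_apply_left (T : Γ →* unitary (H →L[ℂ] H)) (γ : Γ) (φ ψ : H) :
    ⟪(T γ : H →L[ℂ] H) φ, ψ⟫_ℂ = ⟪φ, (T γ⁻¹ : H →L[ℂ] H) ψ⟫_ℂ := by
  have h : ((T γ⁻¹ : unitary (H →L[ℂ] H)) : H →L[ℂ] H) = star (T γ : H →L[ℂ] H) := by
    rw [map_inv]
    rfl
  rw [h, ContinuousLinearMap.star_eq_adjoint, ContinuousLinearMap.adjoint_inner_right]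

lemma unitary_mul_apply (T : Γ →* unitary (H →L[ℂ] H)) (γ γ' : Γ) (ψ : H) :
    (T (γ * γ') : H →L[ℂ] H) ψ = (T γ : H →L[ℂ] H) ((T γ' : H →L[ℂ] H) ψ) := by
  rw [map_mul]
  rfl

namespace IsBracket

lemma pair_eq (hB : IsBracket T B) (φ ψ : H) (γ : Γ) :
    L1.pair (B φ ψ) (star (lam γ)) = ⟪(T γ : H →L[ℂ] H) ψ, φ⟫_ℂ := (hB φ ψ γ).symm

/-- On Fourier coefficients the adjoint conjugates and replaces `γ` by `γ⁻¹`; the inner products do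
the same since `T(γ)* = T(γ⁻¹)`. -/
lemma star_bracket (hB : IsBracket T B) (ψ₁ ψ₂ : H) : star (B ψ₁ ψ₂) = B ψ₂ ψ₁ := by
  refine L1.ext_pair fun γ => ?_
  rw [L1.pair_star, star_star, hB.pair_eq, ← inv_inv γ, ← L1.star_lam γ⁻¹, hB.pair_eq,
    inner_conj_symm, inner_unitary_apply_left, inv_inv]

/-- `τ([ψ, ψ] a* a) = ‖∑ c_i T(γ_i) ψ‖²` for `a = ∑ c_i λ(γ_i)`. -/
lemma pair_star_mul_self_nonneg (hB : IsBracket T B) (ψ : H) {a : vNa Γ}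
    (ha : (a : Op Γ) ∈ trigPoly Γ) : 0 ≤ (L1.pair (B ψ ψ) (star a * a)).re := by
  obtain ⟨c, hc⟩ := Finsupp.mem_span_range_iff_exists_finsupp.1 ha
  have ha' : a = ∑ γ ∈ c.support, c γ • lam γ := by
    refine Subtype.ext ?_
    rw [← hc, Finsupp.sum]
    exact (map_sum (vNa Γ).subtype (fun γ => c γ • lam γ) c.support).symm
  set v : H := ∑ γ ∈ c.support, c γ • (T γ : H →L[ℂ] H) ψ with hv
  have key : L1.pair (B ψ ψ) (star a * a) = ⟪v, v⟫_ℂ := by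
    rw [ha', star_sum, Finset.sum_mul_sum, ← L1.pairLin_apply, map_sum, hv, sum_inner]
    refine Finset.sum_congr rfl fun x _ => ?_
    rw [map_sum, inner_sum]
    refine Finset.sum_congr rfl fun y _ => ?_
    -- `λ(x)* λ(y)` is rewritten as `λ(y⁻¹ x)*`, the form in which the bracket relation applies.
    have h1 : star (c x • lam x) * (c y • lam y)
        = (conj (c x) * c y) • star (lam (y⁻¹ * x)) := by
      rw [star_smul, smul_mul_smul_comm, L1.star_lam, L1.star_lam, L1.lam_mul, mul_inv_rev,
        inv_inv]
      rfl
    rw [h1, map_smul, L1.pairLin_apply, hB.pair_eq, unitary_mul_apply, inner_unitary_apply_left,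
      inv_inv, inner_smul_left, inner_smul_right, smul_eq_mul, mul_assoc]
  rw [key]
  exact inner_self_nonneg (𝕜 := ℂ)

lemma isNonneg (hB : IsBracket T B) (ψ : H) : L1.IsNonneg (B ψ ψ) :=
  L1.isNonneg_of_pair (hB.star_bracket ψ ψ)
    (L1.pair_star_mul_self_nonneg fun _ ha => hB.pair_star_mul_self_nonneg ψ ha)

lemma norm_self (hB : IsBracket T B) (ψ : H) : ‖B ψ ψ‖ = ‖ψ‖ ^ 2 := by
  -- Removes `λ(e)*` from the bracket relation at `γ = e`, leaving `τ([ψ, ψ]) = ‖ψ‖²`.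
  have h1 : L1.rightMul (star (lam 1)) (B ψ ψ) = B ψ ψ := by
    refine L1.ext_pair fun γ => ?_
    rw [L1.pair_rightMul, L1.star_lam, L1.star_lam, L1.lam_mul, inv_one, one_mul]
  have h2 := hB ψ ψ 1
  rw [h1, map_one] at h2
  rw [L1.norm_eq_of_isNonneg (hB.isNonneg ψ), ← h2]
  exact inner_self_eq_norm_sq (𝕜 := ℂ) ψ

end IsBracket

end Bracket

end GroupVN

end

/-! ### The theorem, by comparison of Fourier coefficients. -/

theorem mainTheorem7 {Γ : Type*} [Group Γ] [Countable Γ]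
    {H : Type*} [NormedAddCommGroup H] [InnerProductSpace ℂ H] [CompleteSpace H]
    (T : Γ →* unitary (H →L[ℂ] H)) (B : H → H → GroupVN.L1 Γ) (hB : GroupVN.IsBracket T B) :
    -- sesquilinearity
    (∀ φ₁ φ₂ ψ : H, B (φ₁ + φ₂) ψ = B φ₁ ψ + B φ₂ ψ) ∧
    (∀ (c : ℂ) (φ ψ : H), B (c • φ) ψ = c • B φ ψ) ∧
    (∀ φ ψ₁ ψ₂ : H, B φ (ψ₁ + ψ₂) = B φ ψ₁ + B φ ψ₂) ∧
    (∀ (c : ℂ) (φ ψ : H), B φ (c • ψ) = (starRingEnd ℂ) c • B φ ψ) ∧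
    -- hermitian symmetry
    (∀ ψ₁ ψ₂ : H, star (B ψ₁ ψ₂) = B ψ₂ ψ₁) ∧
    -- equivariance
    (∀ (γ : Γ) (ψ₁ ψ₂ : H),
      B ((T γ : H →L[ℂ] H) ψ₁) ψ₂ = GroupVN.L1.leftMul (GroupVN.lam γ) (B ψ₁ ψ₂)) ∧
    (∀ (γ : Γ) (ψ₁ ψ₂ : H),
      B ψ₁ ((T γ : H →L[ℂ] H) ψ₂) = GroupVN.L1.rightMul (star (GroupVN.lam γ)) (B ψ₁ ψ₂)) ∧
    -- positivity and norm
    (∀ ψ : H, GroupVN.L1.IsNonneg (B ψ ψ) ∧ ‖B ψ ψ‖ = ‖ψ‖ ^ 2) := by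
  open GroupVN in
  refine ⟨fun φ₁ φ₂ ψ => L1.ext_pair fun γ => ?_, fun c φ ψ => L1.ext_pair fun γ => ?_,
    fun φ ψ₁ ψ₂ => L1.ext_pair fun γ => ?_, fun c φ ψ => L1.ext_pair fun γ => ?_,
    hB.star_bracket, fun γ' ψ₁ ψ₂ => L1.ext_pair fun γ => ?_,
    fun γ' ψ₁ ψ₂ => L1.ext_pair fun γ => ?_, fun ψ => ⟨hB.isNonneg ψ, hB.norm_self ψ⟩⟩
  · simp only [L1.pair_add_left, hB.pair_eq, inner_add_right]
  · simp only [L1.pair_smul_left, hB.pair_eq, inner_smul_right]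
  · simp only [L1.pair_add_left, hB.pair_eq, map_add, inner_add_left]
  · simp only [L1.pair_smul_left, hB.pair_eq, map_smul, inner_smul_left]
  · have h : star (lam γ) * lam γ' = star (lam (γ'⁻¹ * γ)) := by
      rw [L1.star_lam, L1.star_lam, L1.lam_mul, mul_inv_rev, inv_inv]
    rw [L1.pair_leftMul, h, hB.pair_eq, hB.pair_eq, unitary_mul_apply,
      inner_unitary_apply_left T γ'⁻¹, inv_inv]
  · have h : star (lam γ') * star (lam γ) = star (lam (γ * γ')) := by
      rw [L1.star_lam, L1.star_lam, L1.star_lam, L1.lam_mul, mul_inv_rev]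
    rw [L1.pair_rightMul, h, hB.pair_eq, hB.pair_eq, unitary_mul_apply]
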